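/- **Setting.** Let $L>0$, and let $\mathcal B\subset\mathbb R^3$ be a bounded open set. Let $\Sigma\subsetneq\partial\mathcal B$ be a regular surface of finite area with curvilinear coordinates $(\xi^1,\xi^2)$, i.e. $\Sigma=X(D)$ for an injective $C^1$ immersion $X$ of a non-empty open set $D\subset\mathbb R^2$. Let $T_\alpha=\partial X/\partial\xi^\alpha$ $(\alpha=1,2)$ be the tangent vectors, $T^\alpha$ the dual basis of the tangent plane, $dA=|T_1\times T_2|\,d\xi^1d\xi^2$ the area element, and (summing over $\alpha$) $$J=\int_\Sigma\bigl(2I-T^\alpha\otimes T_\alpha\bigr)\,dA .$$ Let $\mathcal U=[H^1(\mathcal B)]^3$, and let $\mathcal W=\mathcal R$ be the space of all $w\in[H^1(0,L)]^3$ with $w(0)=0$. On $\mathcal V=\mathcal U\times\mathcal W\times\mathcal R$ put $$\|(u,w,\theta)\|_{\mathcal V}^2=\|u\|_{L^2(\mathcal B)}^2+L^2\|\nabla u\|_{L^2(\mathcal B)}^2+\|w\|_{L^2(0,L)}^2+L^2\|w'\|_{L^2(0,L)}^2+L^2\bigl(\|\theta\|_{L^2(0,L)}^2+L^2\|\theta'\|_{L^2(0,L)}^2\bigr),$$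 and on $\mathcal Q=\mathbb R^3\times\mathbb R^3$ put $\|(\lambda,\mu)\|_{\mathcal Q}^2=L^{-2}|\lambda|^2+|\mu|^2$. The coupling form, which imposes the displacement and rotation link constraints between the body and the beam end $s=L$, is $$b(\lambda,\mu;u,w,\theta)=\lambda\cdot\Bigl(\int_\Sigma T^\alpha\times u_{,\alpha}\,dA-J\,\theta(L)\Bigr)+\int_\Sigma\mu\cdot\bigl(u-w(L)\bigr)\,dA .$$ It is defined for those $(u,w,\theta)\in\mathcal V$ for which $u$ has a trace on $\Sigma$ with weak coordinate derivatives $u_{,\alpha}$ such that the trace and $T^\alpha\times u_{,\alpha}$ lie in $L^2(\Sigma)$. Here the trace of $u$ on $\Sigma$ is the function $u|_\Sigma$ such that, as $r\to0$, the mean value of $|u(y)-u|_\Sigma(x)|$ over $y\in\mathcal B$, $|y-x|<r$, tends to $0$ for almost every $x\in\Sigma$. **Theorem 4.2.** There is a constant $\beta>0$ such that for all $(\lambda,\mu)\in\mathcal Q$ $$\sup_{(u,w,\theta)}\frac{b(\lambda,\mu;u,w,\theta)}{\|(u,w,\theta)\|_{\mathcal V}}\ \ge\ \beta\,\|(\lambda,\mu)\|_{\mathcal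 Q},$$ where the supremum, taken in $[-\infty,\infty]$, is over all non-zero $(u,w,\theta)\in\mathcal V$ for which $b$ is defined. -/

import Mathlib

open MeasureTheory Set Filter Topology

noncomputable section

namespace BeamSolid

/-- The Euclidean space `ℝ³`. -/
abbrev E3 : Type := EuclideanSpace ℝ (Fin 3)

/-- The parameter plane `ℝ²` of the curvilinear coordinates `(ξ¹, ξ²)`. -/
abbrev E2 : Type := EuclideanSpace ℝ (Fin 2)

/-- The cross product of `ℝ³`. -/
def cross (a b : E3) : E3 := WithLp.toLp 2 (crossProduct (WithLp.ofLp a) (WithLp.ofLp b))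

/-- `g` is the weak derivative of `f` in the direction `v` on the open set `Ω`:
`∫_Ω (∂_v φ) f = - ∫_Ω φ g` for every test function `φ ∈ C_c^∞(Ω)`. -/
structure HasWeakPartial {E : Type} [NormedAddCommGroup E] [NormedSpace ℝ E] [MeasureSpace E]
    (Ω : Set E) (v : E) (f g : E → E3) : Prop where
  locallyIntegrable : LocallyIntegrableOn f Ω volume
  locallyIntegrable' : LocallyIntegrableOn g Ω volume
  integral_eq : ∀ φ : E → ℝ, ContDiff ℝ (⊤ : ℕ∞) φ → HasCompactSupport φ → tsupport φ ⊆ Ω →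
    ∫ x in Ω, (fderiv ℝ φ x v) • f x = - ∫ x in Ω, φ x • g x

/-! ### The displacement fields of the solid -/

/-- A vector field of `[H¹(B)]³`, given together with its weak partial derivatives. These are
determined almost everywhere by the field. -/
structure SolidField (B : Set E3) where
  /-- the displacement `u` -/
  val : E3 → E3
  /-- `grad i` is the partial derivative `∂u/∂xᵢ` -/
  grad : Fin 3 → E3 → E3
  memLp_val : MemLp val 2 (volume.restrict B)
  memLp_grad : ∀ i, MemLp (grad i) 2 (volume.restrict B)
  hasWeakPartial : ∀ i, HasWeakPartial B (EuclideanSpace.single i (1 : ℝ)) val (grad i)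

/-- `‖u‖²_𝒰 = ‖u‖² + L² ‖∇u‖²`, with norms in `L²(B)`. -/
def SolidField.normSq {B : Set E3} (L : ℝ) (u : SolidField B) : ℝ :=
  (∫ x in B, ‖u.val x‖ ^ 2) + L ^ 2 * ∑ i, ∫ x in B, ‖u.grad i x‖ ^ 2

/-! ### The displacement and rotation fields of the beam -/

/-- A vector field of `[H¹(0,L)]³` with vanishing trace at `s = 0`, given by its continuous
representative on `[0,L]` together with its weak derivative. -/
structure BeamField (L : ℝ) where
  /-- the field -/
  val : ℝ → E3
  /-- its derivative with respect to arc length -/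
  der : ℝ → E3
  continuousOn : ContinuousOn val (Icc 0 L)
  memLp_val : MemLp val 2 (volume.restrict (Ioo 0 L))
  memLp_der : MemLp der 2 (volume.restrict (Ioo 0 L))
  hasWeakPartial : HasWeakPartial (Ioo 0 L) (1 : ℝ) val der
  clamped : val 0 = 0

/-- The value at the free end `s = L`. -/
def BeamField.tip {L : ℝ} (w : BeamField L) : E3 := w.val L

/-- `‖w‖² + L² ‖w'‖²`, with norms in `L²(0,L)`; this is the square of the norm of `𝒲` and of `ℛ`. -/
def BeamField.normSq {L : ℝ} (w : BeamField L) : ℝ :=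
  (∫ s in Ioo 0 L, ‖w.val s‖ ^ 2) + L ^ 2 * ∫ s in Ioo 0 L, ‖w.der s‖ ^ 2

/-- The product space `𝒱 = 𝒰 × 𝒲 × ℛ`. -/
structure JointField (L : ℝ) (B : Set E3) where
  /-- displacement of the solid -/
  u : SolidField B
  /-- displacement of the beam -/
  w : BeamField L
  /-- rotation of the beam -/
  θ : BeamField L

/-- `‖(u,w,θ)‖_𝒱 = (‖u‖²_𝒰 + ‖w‖²_𝒲 + L² ‖θ‖²_ℛ)^{1/2}`. -/
def JointField.norm {L : ℝ} {B : Set E3} (v : JointField L B) : ℝ :=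
  Real.sqrt (v.u.normSq L + v.w.normSq + L ^ 2 * v.θ.normSq)

/-- `‖(λ,μ)‖_𝒬 = (L⁻² ‖λ‖² + ‖μ‖²)^{1/2}` on the space `𝒬 = ℝ³ × ℝ³` of Lagrange multipliers. -/
def multiplierNorm (L : ℝ) (lam mu : E3) : ℝ :=
  Real.sqrt (1 / L ^ 2 * ‖lam‖ ^ 2 + ‖mu‖ ^ 2)

/-! ### The linked surface -/

/-- A regular surface in `ℝ³` with curvilinear coordinates: an injective `C¹` immersion `X` of a
non-empty open set `D` of the parameter plane. -/
structure Surface where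
  /-- the parameter domain -/
  D : Set E2
  /-- the parametrization -/
  X : E2 → E3
  isOpen : IsOpen D
  nonempty : D.Nonempty
  contDiffOn : ContDiffOn ℝ 1 X D
  injOn : InjOn X D
  immersion : ∀ ξ ∈ D, Function.Injective (fderiv ℝ X ξ)

namespace Surface

variable (S : Surface)

/-- The surface as a subset of `ℝ³`. -/
def carrier : Set E3 := S.X '' S.D

/-- The tangent vector `T_α = ∂X/∂ξ^α`. -/
def tangent (α : Fin 2) (ξ : E2) : E3 := fderiv ℝ S.X ξ (EuclideanSpace.single α (1 : ℝ))

/-- The metric `g_{αβ} = T_α · T_β`. -/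
def metric (ξ : E2) : Matrix (Fin 2) (Fin 2) ℝ :=
  Matrix.of fun α β => inner ℝ (S.tangent α ξ) (S.tangent β ξ)

/-- The dual basis `T^α = g^{αβ} T_β` of the tangent plane. -/
def dual (α : Fin 2) (ξ : E2) : E3 := ∑ β, (S.metric ξ)⁻¹ α β • S.tangent β ξ

/-- The area measure `dA = |T₁ × T₂| dξ` in the coordinates `ξ`. -/
def area : Measure E2 :=
  (volume.restrict S.D).withDensity
    fun ξ => ENNReal.ofReal ‖cross (S.tangent 0 ξ) (S.tangent 1 ξ)‖

/-- The section tensor `J = ∫_Σ (2 I - T^α ⊗ T_α) dA`. -/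
def sectionTensor : E3 →L[ℝ] E3 :=
  ∫ ξ, ((2 : ℝ) • ContinuousLinearMap.id ℝ E3 -
    ∑ α, InnerProductSpace.rankOne ℝ (S.dual α ξ) (S.tangent α ξ)) ∂S.area

end Surface

/-! ### Traces on the surface and the coupling form -/

/-- The boundary values of `u` on `Σ ⊆ ∂B` that enter the coupling form, in the coordinates `ξ`:
the trace `u|_Σ`, with `⨍_{B ∩ B(x,r)} |u(y) - u|_Σ(x)| dy → 0` as `r → 0` for almost every
`x ∈ Σ`, and its weak derivatives `u_{,α}` along the coordinate lines, such that `u|_Σ` and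
`T^α × u_{,α}` lie in `L²(Σ)`. All of them are determined almost everywhere by `u`. -/
structure SurfaceTrace (B : Set E3) (S : Surface) (u : E3 → E3) where
  /-- the trace `u|_Σ` -/
  val : E2 → E3
  /-- `der α` is `u_{,α}` -/
  der : Fin 2 → E2 → E3
  isTrace : ∀ᵐ ξ ∂(volume.restrict S.D),
    Tendsto (fun r : ℝ => ⨍ y in Metric.ball (S.X ξ) r ∩ B, ‖u y - val ξ‖) (𝓝[>] 0) (𝓝 0)
  hasWeakPartial : ∀ α, HasWeakPartial S.D (EuclideanSpace.single α (1 : ℝ)) val (der α)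
  memLp_val : MemLp val 2 S.area
  memLp_rot : MemLp (fun ξ => ∑ α, cross (S.dual α ξ) (der α ξ)) 2 S.area

/-- The coupling form
`b(γ,ν;u,w,θ) = γ · (∫_Σ T^α × u_{,α} dA - J θ(L)) + ∫_Σ ν · (u - w(L)) dA`. -/
def couplingForm {L : ℝ} {B : Set E3} (S : Surface) (γ ν : E3) (v : JointField L B)
    (τ : SurfaceTrace B S v.u.val) : ℝ :=
  inner ℝ γ ((∫ ξ, ∑ α, cross (S.dual α ξ) (τ.der α ξ) ∂S.area) - S.sectionTensor v.θ.tip) +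
    ∫ ξ, inner ℝ ν (τ.val ξ - v.w.tip) ∂S.area

end BeamSolid

end

/-! The solid may be left at rest: on fields with `u = 0`, whose trace vanishes, the coupling form is
`-λ · J θ(L) - |Σ| μ · w(L)`, and it suffices to control both multipliers with the beam alone.
At each point of `Σ` the tensor `T^α ⊗ T_α` is the orthogonal projection onto the tangent plane
(`Surface.norm_tangentProj_le`), so `2 I - T^α ⊗ T_α ≥ I`, and integration gives
`λ · J λ ≥ |Σ| |λ|²` (`Surface.area_mul_le_inner_sectionTensor`). Moreover `|Σ| > 0`, because
`T₁ × T₂` vanishes nowhere (`Surface.area_univ_pos`).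

Take the linear fields `w(s) = -(s/L) μ` and `θ(s) = -(s/L) L⁻² λ`. Then the coupling form is at least
`|Σ| (L⁻² |λ|² + |μ|²)`, while the norm of `(0, w, θ)` is exactly `√(4L/3)` times the norm of
`(λ, μ)`. So `β = |Σ| / √(4L/3)` works. For `λ = μ = 0` any non-zero field shows that the
supremum is nonnegative. -/

namespace BeamSolid

/-! ### The tangent projection and the section tensor -/

namespace Surface

variable (S : Surface)

lemma continuousOn_tangent (α : Fin 2) : ContinuousOn (S.tangent α) S.D :=
  (S.contDiffOn.continuousOn_fderiv_of_isOpen S.isOpen le_rfl).clm_apply continuousOn_const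

lemma linearIndependent_tangent {ξ : E2} (hξ : ξ ∈ S.D) :
    LinearIndependent ℝ (fun α => S.tangent α ξ) := by
  have h := (EuclideanSpace.basisFun (Fin 2) ℝ).toBasis.linearIndependent.map'
    (fderiv ℝ S.X ξ : E2 →ₗ[ℝ] E3) (LinearMap.ker_eq_bot.2 (S.immersion ξ hξ))
  have e : (fun α => S.tangent α ξ) =
      (fderiv ℝ S.X ξ : E2 →ₗ[ℝ] E3) ∘ (EuclideanSpace.basisFun (Fin 2) ℝ).toBasis := by
    ext α : 1
    simp [tangent]
  rw [e]
  exact h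

lemma det_metric_ne_zero {ξ : E2} (hξ : ξ ∈ S.D) : (S.metric ξ).det ≠ 0 :=
  (Matrix.posDef_gram_of_linearIndependent (S.linearIndependent_tangent hξ)).det_pos.ne'

lemma cross_tangent_ne_zero {ξ : E2} (hξ : ξ ∈ S.D) :
    cross (S.tangent 0 ξ) (S.tangent 1 ξ) ≠ 0 := by
  have h := (S.linearIndependent_tangent hξ).map'
    (WithLp.linearEquiv 2 ℝ (Fin 3 → ℝ)).toLinearMap (LinearEquiv.ker _)
  have h' : crossProduct (WithLp.ofLp (S.tangent 0 ξ)) (WithLp.ofLp (S.tangent 1 ξ)) ≠ 0 := by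
    rw [crossProduct_ne_zero_iff_linearIndependent]
    have e : ![WithLp.ofLp (S.tangent 0 ξ), WithLp.ofLp (S.tangent 1 ξ)] =
        (WithLp.linearEquiv 2 ℝ (Fin 3 → ℝ)).toLinearMap ∘ fun α => S.tangent α ξ := by
      ext α : 1
      fin_cases α <;> rfl
    rw [e]
    exact h
  intro h0
  exact h' ((WithLp.toLp_eq_zero 2).1 h0)

lemma continuousOn_cross_tangent :
    ContinuousOn (fun ξ => cross (S.tangent 0 ξ) (S.tangent 1 ξ)) S.D := by
  have hT := fun α => S.continuousOn_tangent α
  have hi : ∀ α i, ContinuousOn (fun ξ => S.tangent α ξ i) S.D := fun α i =>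
    (EuclideanSpace.proj i : E3 →L[ℝ] ℝ).continuous.comp_continuousOn (hT α)
  refine (PiLp.continuous_toLp 2 _).comp_continuousOn (continuousOn_pi.2 fun i => ?_)
  simp only [cross_apply]
  fin_cases i
  · exact ((hi 0 1).mul (hi 1 2)).sub ((hi 0 2).mul (hi 1 1))
  · exact ((hi 0 2).mul (hi 1 0)).sub ((hi 0 0).mul (hi 1 2))
  · exact ((hi 0 0).mul (hi 1 1)).sub ((hi 0 1).mul (hi 1 0))

lemma continuousOn_dual (α : Fin 2) : ContinuousOn (S.dual α) S.D := by
  have hT := fun α => S.continuousOn_tangent α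
  have hg : ContinuousOn S.metric S.D :=
    continuousOn_pi.2 fun i => continuousOn_pi.2 fun j => (hT i).inner (hT j)
  have hinv : ContinuousOn (fun ξ => (S.metric ξ)⁻¹) S.D := by
    simp only [Matrix.inv_def, Ring.inverse_eq_inv']
    exact ((continuous_id.matrix_det.comp_continuousOn hg).inv₀
      fun ξ hξ => S.det_metric_ne_zero hξ).smul (continuous_id.matrix_adjugate.comp_continuousOn hg)
  exact continuousOn_finsetSum _ fun β _ =>
    (continuousOn_pi.1 (continuousOn_pi.1 hinv α) β).smul (hT β)

/-- The tensor `T^α ⊗ T_α`, which is the orthogonal projection onto the tangent plane. -/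
noncomputable def tangentProj (ξ : E2) : E3 →L[ℝ] E3 :=
  ∑ α, InnerProductSpace.rankOne ℝ (S.dual α ξ) (S.tangent α ξ)

lemma tangentProj_apply (ξ : E2) (x : E3) :
    S.tangentProj ξ x = ∑ α, inner ℝ (S.tangent α ξ) x • S.dual α ξ := by
  simp [tangentProj]

lemma continuousOn_tangentProj : ContinuousOn S.tangentProj S.D := by
  refine continuousOn_finsetSum _ fun α _ => ?_
  exact ((InnerProductSpace.rankOne ℝ).continuous.comp_continuousOn
    (S.continuousOn_dual α)).clm_apply (S.continuousOn_tangent α)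

lemma inner_dual_tangent {ξ : E2} (hξ : ξ ∈ S.D) (α γ : Fin 2) :
    inner ℝ (S.dual α ξ) (S.tangent γ ξ) = (1 : Matrix (Fin 2) (Fin 2) ℝ) α γ := by
  rw [← Matrix.nonsing_inv_mul _ (S.det_metric_ne_zero hξ).isUnit, Matrix.mul_apply]
  simp only [dual, sum_inner, real_inner_smul_left]
  -- The entries of the metric are by definition the inner products of the tangent vectors.
  rfl

lemma inner_tangentProj_tangent {ξ : E2} (hξ : ξ ∈ S.D) (x : E3) (γ : Fin 2) :
    inner ℝ (S.tangentProj ξ x) (S.tangent γ ξ) = inner ℝ x (S.tangent γ ξ) := by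
  rw [tangentProj_apply, sum_inner, Finset.sum_congr rfl fun α _ => by
    rw [inner_smul_left, S.inner_dual_tangent hξ]]
  simp [Matrix.one_apply, real_inner_comm]

/-- This expresses that `T^α ⊗ T_α` is a symmetric idempotent: `x - P x` is orthogonal to the tangent
plane, which contains `P x`. -/
lemma norm_tangentProj_sq {ξ : E2} (hξ : ξ ∈ S.D) (x : E3) :
    ‖S.tangentProj ξ x‖ ^ 2 = inner ℝ x (S.tangentProj ξ x) := by
  have h : ∀ α, inner ℝ (S.tangentProj ξ x) (S.dual α ξ) = inner ℝ x (S.dual α ξ) := fun α => by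
    simp only [dual, inner_sum, inner_smul_right, S.inner_tangentProj_tangent hξ]
  rw [← real_inner_self_eq_norm_sq]
  nth_rewrite 2 3 [tangentProj_apply]
  simp only [inner_sum, inner_smul_right, h]

lemma norm_tangentProj_le {ξ : E2} (hξ : ξ ∈ S.D) (x : E3) : ‖S.tangentProj ξ x‖ ≤ ‖x‖ := by
  have h := S.norm_tangentProj_sq hξ x
  have h' := real_inner_le_norm x (S.tangentProj ξ x)
  by_contra! hlt
  nlinarith [norm_nonneg x]

lemma ae_area_mem : ∀ᵐ ξ ∂S.area, ξ ∈ S.D :=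
  (withDensity_absolutelyContinuous _ _).ae_le (ae_restrict_mem S.isOpen.measurableSet)

lemma area_univ_pos : 0 < S.area univ := by
  have hD := S.isOpen.measurableSet
  have hac : volume.restrict S.D ≪ S.area := by
    refine withDensity_absolutelyContinuous' ?_ ?_
    · exact (S.continuousOn_cross_tangent.norm.aemeasurable hD).ennreal_ofReal
    · filter_upwards [ae_restrict_mem hD] with ξ hξ
      simpa using S.cross_tangent_ne_zero hξ
  rw [pos_iff_ne_zero]
  intro h
  have := hac h
  rw [Measure.restrict_apply_univ] at this
  exact (S.isOpen.measure_pos volume S.nonempty).ne' this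

lemma sectionTensor_eq :
    S.sectionTensor = ∫ ξ, ((2 : ℝ) • ContinuousLinearMap.id ℝ E3 - S.tangentProj ξ) ∂S.area :=
  rfl

lemma integrable_sectionTensor (hA : S.area univ < ⊤) :
    Integrable (fun ξ => (2 : ℝ) • ContinuousLinearMap.id ℝ E3 - S.tangentProj ξ) S.area := by
  have : IsFiniteMeasure S.area := ⟨hA⟩
  refine (integrable_const _).sub (Integrable.of_bound (C := 1) ?_ ?_)
  · exact (S.continuousOn_tangentProj.aestronglyMeasurable S.isOpen.measurableSet).mono_ac
      (withDensity_absolutelyContinuous _ _)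
  · filter_upwards [S.ae_area_mem] with ξ hξ
    exact ContinuousLinearMap.opNorm_le_bound _ zero_le_one fun x => by
      simpa using S.norm_tangentProj_le hξ x

/-- The section tensor is bounded below by the area, since `2 I - T^α ⊗ T_α ≥ I`. -/
lemma area_mul_le_inner_sectionTensor (hA : S.area univ < ⊤) (x : E3) :
    S.area.real univ * ‖x‖ ^ 2 ≤ inner ℝ x (S.sectionTensor x) := by
  have : IsFiniteMeasure S.area := ⟨hA⟩
  have hi := S.integrable_sectionTensor hA
  have hix := hi.apply_continuousLinearMap x
  rw [sectionTensor_eq, ContinuousLinearMap.integral_apply hi, ← integral_inner hix,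
    ← smul_eq_mul, ← integral_const]
  refine integral_mono_ae (integrable_const _) (hix.const_inner x) ?_
  filter_upwards [S.ae_area_mem] with ξ hξ
  have h1 : inner ℝ x (S.tangentProj ξ x) ≤ ‖x‖ ^ 2 := by
    rw [← S.norm_tangentProj_sq hξ]
    gcongr
    exact S.norm_tangentProj_le hξ x
  simp only [sub_apply, smul_apply,
    ContinuousLinearMap.id_apply, inner_sub_right, inner_smul_right, real_inner_self_eq_norm_sq]
  linarith

end Surface

/-! ### Linear fields of the beam and the solid at rest -/

lemma hasWeakPartial_zero {E : Type} [NormedAddCommGroup E] [NormedSpace ℝ E] [MeasureSpace E]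
    (Ω : Set E) (v : E) : HasWeakPartial Ω v 0 0 where
  locallyIntegrable := (locallyIntegrable_zero).locallyIntegrableOn Ω
  locallyIntegrable' := (locallyIntegrable_zero).locallyIntegrableOn Ω
  integral_eq := by simp

lemma hasWeakPartial_linear {L : ℝ} (hL : 0 < L) (a : E3) :
    HasWeakPartial (Ioo 0 L) (1 : ℝ) (fun s => s • a) (fun _ => a) where
  locallyIntegrable := (Continuous.locallyIntegrable (by fun_prop)).locallyIntegrableOn _
  locallyIntegrable' := (Continuous.locallyIntegrable (by fun_prop)).locallyIntegrableOn _
  integral_eq := fun φ hφ _ hsupp => by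
    have hout : ∀ s, s ∉ Ioo 0 L → φ s = 0 := fun s hs =>
      image_eq_zero_of_notMem_tsupport fun h => hs (hsupp h)
    have hd : Continuous (deriv φ) := hφ.continuous_deriv (by simp)
    have hi1 : IntervalIntegrable (fun s => deriv φ s • s • a) volume 0 L :=
      Continuous.intervalIntegrable (by fun_prop) _ _
    have hi2 : IntervalIntegrable (fun s => φ s • a) volume 0 L :=
      Continuous.intervalIntegrable (hφ.continuous.smul continuous_const) _ _
    have hder : ∀ s ∈ uIcc 0 L,
        HasDerivAt (fun s => φ s • s • a) (deriv φ s • s • a + φ s • a) s := fun s _ => by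
      have h1 : HasDerivAt φ (deriv φ s) s :=
        (hφ.differentiable (by simp) s).hasDerivAt
      have h2 : HasDerivAt (fun s : ℝ => s • a) a s := by
        simpa using (hasDerivAt_id s).smul_const a
      rw [add_comm]
      exact h1.smul h2
    have key := intervalIntegral.integral_eq_sub_of_hasDerivAt hder (hi1.add hi2)
    rw [intervalIntegral.integral_add hi1 hi2, hout L (by simp), hout 0 (by simp)] at key
    simp only [intervalIntegral.integral_of_le hL.le, integral_Ioc_eq_integral_Ioo] at key
    simp only [fderiv_apply_one_eq_deriv]
    exact eq_neg_of_add_eq_zero_left (by simpa using key)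

lemma memLp_Ioo_of_continuous {f : ℝ → E3} (hf : Continuous f) (L : ℝ) :
    MemLp f 2 (volume.restrict (Ioo 0 L)) := by
  obtain ⟨C, hC⟩ := isCompact_Icc.exists_bound_of_continuousOn (hf.continuousOn (s := Icc 0 L))
  refine MemLp.of_bound hf.aestronglyMeasurable C ?_
  filter_upwards [ae_restrict_mem measurableSet_Ioo] with s hs
  exact hC s (Ioo_subset_Icc_self hs)

/-- The linear beam field `s ↦ s a`. -/
def BeamField.linear {L : ℝ} (hL : 0 < L) (a : E3) : BeamField L where
  val s := s • a
  der _ := a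
  continuousOn := by fun_prop
  memLp_val := memLp_Ioo_of_continuous (by fun_prop) L
  memLp_der := memLp_Ioo_of_continuous continuous_const L
  hasWeakPartial := hasWeakPartial_linear hL a
  clamped := zero_smul _ _

lemma BeamField.normSq_linear {L : ℝ} (hL : 0 < L) (a : E3) :
    (BeamField.linear hL a).normSq = 4 / 3 * L ^ 3 * ‖a‖ ^ 2 := by
  have h1 : ∫ s in Ioo 0 L, ‖s • a‖ ^ 2 = L ^ 3 / 3 * ‖a‖ ^ 2 := by
    simp only [norm_smul, mul_pow, Real.norm_eq_abs, sq_abs]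
    rw [integral_mul_const, ← integral_Ioc_eq_integral_Ioo,
      ← intervalIntegral.integral_of_le hL.le, integral_pow]
    norm_num
  simp only [normSq, linear, h1, setIntegral_const, smul_eq_mul, Real.volume_real_Ioo_of_le hL.le]
  ring

/-- The solid at rest. -/
def SolidField.rest (B : Set E3) : SolidField B where
  val := 0
  grad _ := 0
  memLp_val := MemLp.zero
  memLp_grad _ := MemLp.zero
  hasWeakPartial _ := hasWeakPartial_zero _ _

/-- The solid at rest, with linear displacement `s ↦ s a` and rotation `s ↦ s c` of the beam. -/
def JointField.linear {L : ℝ} (hL : 0 < L) (B : Set E3) (a c : E3) : JointField L B where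
  u := SolidField.rest B
  w := BeamField.linear hL a
  θ := BeamField.linear hL c

/-- The zero trace, with zero coordinate derivatives, of the solid at rest. -/
def JointField.linearTrace {L : ℝ} (hL : 0 < L) (B : Set E3) (S : Surface) (a c : E3) :
    SurfaceTrace B S (JointField.linear hL B a c).u.val where
  val := 0
  der _ := 0
  isTrace := by simp [linear, SolidField.rest]
  hasWeakPartial _ := hasWeakPartial_zero _ _
  memLp_val := MemLp.zero
  memLp_rot := by simp [cross]

lemma JointField.norm_linear {L : ℝ} (hL : 0 < L) (B : Set E3) (a c : E3) :
    (JointField.linear hL B a c).norm =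
      Real.sqrt (4 / 3 * L ^ 3 * (‖a‖ ^ 2 + L ^ 2 * ‖c‖ ^ 2)) := by
  simp only [norm, linear, BeamField.normSq_linear]
  congr 1
  simp [SolidField.normSq, SolidField.rest]
  ring

/-- The linear fields take the values `L a` and `L c` at the tip `s = L`. -/
lemma couplingForm_linear {L : ℝ} (hL : 0 < L) (B : Set E3) (S : Surface) (γ ν a c : E3) :
    couplingForm S γ ν (JointField.linear hL B a c) (JointField.linearTrace hL B S a c) =
      -(L * inner ℝ γ (S.sectionTensor c)) - S.area.real univ * (L * inner ℝ ν a) := by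
  simp [couplingForm, JointField.linear, JointField.linearTrace, BeamField.tip, BeamField.linear,
    cross, inner_smul_right]
  ring

end BeamSolid

/-! ### The inf-sup inequality -/

theorem theorem4p2 (L : ℝ) (hL : 0 < L)
    (B : Set BeamSolid.E3) (hBopen : IsOpen B) (hBbdd : Bornology.IsBounded B)
    (S : BeamSolid.Surface) (hS : S.carrier ⊂ frontier B) (hArea : S.area Set.univ < ⊤) :
    ∃ β : ℝ, 0 < β ∧ ∀ lam mu : BeamSolid.E3,
      ((β * BeamSolid.multiplierNorm L lam mu : ℝ) : EReal) ≤
        ⨆ (v : BeamSolid.JointField L B) (τ : BeamSolid.SurfaceTrace B S v.u.val)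
          (_ : v.norm ≠ 0), ((BeamSolid.couplingForm S lam mu v τ / v.norm : ℝ) : EReal) := by
  set A := S.area.real Set.univ with hA
  have hApos : 0 < A := ENNReal.toReal_pos S.area_univ_pos.ne' hArea.ne
  have hK : 0 < 4 / 3 * L := by positivity
  refine ⟨A / Real.sqrt (4 / 3 * L), by positivity, fun lam mu => ?_⟩
  set N := BeamSolid.multiplierNorm L lam mu with hN
  have hN2 : N ^ 2 = 1 / L ^ 2 * ‖lam‖ ^ 2 + ‖mu‖ ^ 2 := Real.sq_sqrt (by positivity)
  have hN0 : 0 ≤ N := Real.sqrt_nonneg _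
  rcases hN0.eq_or_lt with h0 | hNpos
  · -- Both multipliers vanish; the field `w(s) = s e₁` makes the quotient `0`.
    rw [← h0] at hN2
    have hlam : lam = 0 := by
      by_contra h
      have : 0 < 1 / L ^ 2 * ‖lam‖ ^ 2 := by positivity
      nlinarith [sq_nonneg ‖mu‖]
    have hmu : mu = 0 := by
      by_contra h
      have : 0 < ‖mu‖ ^ 2 := by positivity
      have : 0 ≤ 1 / L ^ 2 * ‖lam‖ ^ 2 := by positivity
      nlinarith
    refine le_iSup_of_le (BeamSolid.JointField.linear hL B (EuclideanSpace.single 0 1) 0)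
      (le_iSup_of_le (BeamSolid.JointField.linearTrace hL B S _ _) (le_iSup_of_le ?_ ?_))
    · rw [BeamSolid.JointField.norm_linear]
      simp only [PiLp.norm_single, norm_zero]
      exact (Real.sqrt_pos.2 (by norm_num; positivity)).ne'
    · rw [BeamSolid.couplingForm_linear, ← h0]
      simp [hlam, hmu]
  · -- The factor `L⁻³ = L⁻¹ L⁻²` gives both multipliers the weights of `N ^ 2`, in the norm of `v` as
    -- well as in the coupling form.
    let v := BeamSolid.JointField.linear hL B (-(1 / L) • mu) (-(1 / L ^ 3) • lam)
    have hvn : v.norm = Real.sqrt (4 / 3 * L) * N := by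
      rw [BeamSolid.JointField.norm_linear, hN, BeamSolid.multiplierNorm,
        ← Real.sqrt_mul hK.le]
      congr 1
      simp only [norm_smul, norm_neg, mul_pow, Real.norm_eq_abs, sq_abs]
      field_simp
      ring
    have hb : A * N ^ 2 ≤ BeamSolid.couplingForm S lam mu v
        (BeamSolid.JointField.linearTrace hL B S _ _) := by
      have hJ := S.area_mul_le_inner_sectionTensor hArea lam
      rw [BeamSolid.couplingForm_linear, map_smul, inner_smul_right, inner_smul_right,
        real_inner_self_eq_norm_sq, hN2, ← hA]
      have hJ' := mul_le_mul_of_nonneg_left hJ (by positivity : 0 ≤ 1 / L ^ 2)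
      have e1 : -(L * (-(1 / L ^ 3) * inner ℝ lam (S.sectionTensor lam))) =
          1 / L ^ 2 * inner ℝ lam (S.sectionTensor lam) := by
        field_simp
      have e2 : A * (L * (-(1 / L) * ‖mu‖ ^ 2)) = -(A * ‖mu‖ ^ 2) := by
        field_simp
      rw [e1, e2]
      linarith
    have hvpos : 0 < v.norm := hvn ▸ mul_pos (Real.sqrt_pos.2 hK) hNpos
    refine le_iSup_of_le v (le_iSup_of_le (BeamSolid.JointField.linearTrace hL B S _ _)
      (le_iSup_of_le hvpos.ne' (EReal.coe_le_coe_iff.2 ?_)))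
    rw [le_div_iff₀ hvpos, hvn]
    refine le_trans (le_of_eq ?_) hb
    have := (Real.sqrt_pos.2 hK).ne'
    field_simp
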